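/- For a partition $\mu$ and a sequence $\chi=(\chi_1,\chi_2,\dots)$ of non-negative integers with finitely many non-zero terms, the Kostka number $K_{\mu\chi}$ is the number of semistandard Young tableaux of shape $\mu$ and weight $\chi$ (that is, with exactly $\chi_i$ entries equal to $i$ for every $i$). The Schur function of $\mu$ is $s_\mu=\sum_T x^T$, the sum over all semistandard Young tableaux $T$ of shape $\mu$ with positive integer entries. For partitions $\lambda,\mu$, the product $s_\lambda s_\mu$ has a unique expansion $s_\lambda s_\mu=\sum_\nu c^\nu_{\lambda\mu}s_\nu$ as a finite integer linear combination of Schur functions, and $c^\nu_{\lambda\mu}$ are the Littlewood–Richardson coefficients. Let $\lambda,\mu,\nu$ be partitions, padded with zeros, such that $\nu_i=\lambda_i+\chi_i$ for all $i$, where all $\chi_i\ge 0$ and $\sum_i\chi_i=|\mu|$. Then $$c^{\nu}_{\lambda\mu}\le K_{\mu\chi}=K_{\mu,\nu-\lambda}.$$ Equality holds if $\nu/\lambda$ is a horizontal strip, that is, if no two boxes of the skew shape $\nu/\lambda$ lie in the same column. -/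

import Mathlib

noncomputable section

/-- The weight (content) of a semistandard Young tableau `T`: the exponent vector whose value at `k`
is the number of cells of `T` with entry `k`. Entries, like all indices here, start from `0`. -/
def SemistandardYoungTableau.weight {μ : YoungDiagram} (T : SemistandardYoungTableau μ) :
    ℕ →₀ ℕ :=
  ∑ c ∈ μ.cells, Finsupp.single (T c.1 c.2) 1

/-- There are only finitely many semistandard Young tableaux of given shape and weight, so that
counting them with `Nat.card` is meaningful. -/
theorem SemistandardYoungTableau.finite_weight_eq (μ : YoungDiagram) (χ : ℕ →₀ ℕ) :
    Finite {T : SemistandardYoungTableau μ // T.weight = χ} := by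
  classical
  have key : ∀ (T : {T : SemistandardYoungTableau μ // T.weight = χ}) (c : μ.cells),
      T.1 c.1.1 c.1.2 ∈ χ.support := by
    rintro ⟨T, rfl⟩ ⟨c, hc⟩
    rw [Finsupp.mem_support_iff]
    change (∑ d ∈ μ.cells, Finsupp.single (T d.1 d.2) 1) (T c.1 c.2) ≠ 0
    rw [Finsupp.finsetSum_apply]
    have h := Finset.single_le_sum (f := fun d => Finsupp.single (T d.1 d.2) 1 (T c.1 c.2))
      (fun _ _ => Nat.zero_le _) hc
    simp only [Finsupp.single_eq_same] at h
    omega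
  refine Finite.of_injective
    (fun (T : {T : SemistandardYoungTableau μ // T.weight = χ}) (c : μ.cells) =>
      (⟨T.1 c.1.1 c.1.2, key T c⟩ : χ.support)) ?_
  intro T T' h
  apply Subtype.ext
  apply SemistandardYoungTableau.ext
  intro i j
  by_cases hij : (i, j) ∈ μ
  · have := congrFun h ⟨(i, j), hij⟩
    exact congrArg Subtype.val this
  · rw [T.1.zeros hij, T'.1.zeros hij]

namespace YoungDiagram

/-- The Kostka number `K_{μ χ}`: the number of semistandard Young tableaux of shape `μ` and
weight `χ`, where the (weak) composition `χ` is extended by zeros. -/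
def kostka (μ : YoungDiagram) (χ : ℕ →₀ ℕ) : ℕ :=
  Nat.card {T : SemistandardYoungTableau μ // T.weight = χ}

/-- The Schur function `s_μ = ∑_T x^T` in the variables `x_0, x_1, x_2, …`, the sum being over all
semistandard Young tableaux `T` of shape `μ`. As a formal power series its coefficient at the
monomial `x^α` is the number of those `T` that have weight `α`. -/
def schur (μ : YoungDiagram) : MvPowerSeries ℕ ℤ :=
  fun α => (Nat.card {T : SemistandardYoungTableau μ // T.weight = α} : ℤ)

/-- `c` is the family of coefficients of an expansion `f = ∑_ν c_ν s_ν` of `f` as a finite linear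
combination of Schur functions. -/
def IsSchurExpansion (f : MvPowerSeries ℕ ℤ) (c : YoungDiagram →₀ ℤ) : Prop :=
  f = c.sum fun ν z => z • schur ν

open Classical in
/-- The Littlewood-Richardson coefficient `c^ν_{λ μ}`: the coefficient of `s_ν` in the expansion
`s_λ s_μ = ∑_ν c^ν_{λ μ} s_ν` of a product of Schur functions in Schur functions. -/
def lrCoeff (lam μ ν : YoungDiagram) : ℤ :=
  if h : ∃ c : YoungDiagram →₀ ℤ, IsSchurExpansion (schur lam * schur μ) c then h.choose ν else 0

/-- The skew shape `ν/λ` is a horizontal strip: `λ ⊆ ν` and no two boxes of `ν/λ` lie in the same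
column. A box `(i, j)` is in row `i` and column `j`. -/
def IsHorizontalStrip (ν lam : YoungDiagram) : Prop :=
  lam ≤ ν ∧ ∀ i i' j : ℕ, (i, j) ∈ ν → (i, j) ∉ lam → (i', j) ∈ ν → (i', j) ∉ lam → i = i'

end YoungDiagram

end

/-! The Littlewood–Richardson rule is proved by Stembridge's sign-reversing involution; the
inequality then becomes an inclusion of finite sets. Write a_α for the antisymmetrization of x^α in
the first n variables. Since s_μ is symmetric, a_{λ+ρ} s_μ is the sum of a_{λ+wt(T)+ρ} over the
tableaux T of shape μ. Call T good if λ plus the weight of the columns ≥ j of T is a partition for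
every j. A bad T has a first violation, reading columns from right to left. There the two offending
coordinates of λ + weight + ρ agree, so a Bender–Knuth toggle of the columns further left swaps them
in λ+wt(T)+ρ and negates the alternant. Bad terms cancel (`alternant_mul_schurPoly`).

For λ = 0 only the highest weight tableau is good, so a_ρ s_μ = a_{μ+ρ}. Cancelling a_ρ expands s_λ
s_μ as the sum of s_{λ+wt(T)} over good T; independence of Schur functions makes c^ν the number of
good T of weight χ = ν − λ. Dropping goodness gives the Kostka number. For a horizontal strip,
ν_{k+1} ≤ λ_k makes every T of weight χ good.

Tableaux are encoded as Gelfand–Tsetlin patterns, where toggles are piecewise linear and most checks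
become linear arithmetic. -/

open Finset

/-! ### Gelfand–Tsetlin patterns and their weights -/

/-- A Gelfand–Tsetlin pattern with top row `μ`: an interlacing family of partitions
`row 0 = 0, row 1, row 2, …` that is eventually equal to `μ`. -/
@[ext] structure GTPattern (μ : YoungDiagram) where
  row : ℕ → ℕ → ℕ
  row_zero : ∀ i, row 0 i = 0
  row_le_succ : ∀ k i, row k i ≤ row (k + 1) i
  row_succ_le : ∀ k i, row (k + 1) (i + 1) ≤ row k i
  eventually_top : ∃ n, ∀ k, n ≤ k → ∀ i, row k i = μ.rowLen i

namespace YoungDiagram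

theorem rowLen_eq_zero {μ : YoungDiagram} {i : ℕ} (h : μ.colLen 0 ≤ i) : μ.rowLen i = 0 := by
  by_contra h0
  have h1 : (i, 0) ∈ μ := mem_iff_lt_rowLen.2 (Nat.pos_of_ne_zero h0)
  exact absurd (mem_iff_lt_colLen.1 h1) (by omega)

theorem ext_rowLen {μ ν : YoungDiagram} (h : ∀ i, μ.rowLen i = ν.rowLen i) : μ = ν := by
  apply SetLike.ext
  rintro ⟨i, j⟩
  rw [mem_iff_lt_rowLen, mem_iff_lt_rowLen, h]

end YoungDiagram

namespace GTPattern

variable {μ : YoungDiagram} (g : GTPattern μ)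

theorem row_mono (i : ℕ) : Monotone fun k => g.row k i :=
  monotone_nat_of_le_succ fun k => g.row_le_succ k i

theorem row_anti (k : ℕ) : Antitone (g.row k) :=
  antitone_nat_of_succ_le fun i => (g.row_le_succ k (i + 1)).trans (g.row_succ_le k i)

theorem row_le_rowLen (k i : ℕ) : g.row k i ≤ μ.rowLen i := by
  obtain ⟨n, hn⟩ := g.eventually_top
  rw [← hn (max n k) (le_max_left _ _) i]
  exact g.row_mono i (le_max_right _ _)

theorem row_eq_zero {k i : ℕ} (h : μ.colLen 0 ≤ i) : g.row k i = 0 :=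
  Nat.le_zero.1 ((g.row_le_rowLen k i).trans (YoungDiagram.rowLen_eq_zero h).le)

/-- The number of boxes in columns `≥ j` with entry `< k`. -/
def tail (j k : ℕ) : ℕ := ∑ i ∈ range (μ.colLen 0), (g.row k i - j)

theorem tail_mono (j : ℕ) : Monotone (g.tail j) := fun _ _ h =>
  sum_le_sum fun i _ => Nat.sub_le_sub_right (g.row_mono i h) j

/-- The pattern describes a tableau all of whose entries are `< n`. -/
def BoundedBy (n : ℕ) : Prop := ∀ k, n ≤ k → ∀ i, g.row k i = μ.rowLen i

theorem BoundedBy.mono {g : GTPattern μ} {m n : ℕ} (h : g.BoundedBy m) (hmn : m ≤ n) :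
    g.BoundedBy n := fun k hk => h k (hmn.trans hk)

theorem BoundedBy.tail_eq {g : GTPattern μ} {n k : ℕ} (h : g.BoundedBy n) (hk : n ≤ k) (j : ℕ) :
    g.tail j k = ∑ i ∈ range (μ.colLen 0), (μ.rowLen i - j) :=
  sum_congr rfl fun i _ => by rw [h k hk]

theorem finite_support_weight :
    (Function.support fun k => g.tail 0 (k + 1) - g.tail 0 k).Finite := by
  obtain ⟨n, hn⟩ : ∃ n, g.BoundedBy n := g.eventually_top
  refine (Set.finite_lt_nat n).subset fun k hk => ?_
  by_contra h
  rw [Set.mem_ofPred_eq, not_lt] at h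
  exact hk (by simp only [hn.tail_eq h, hn.tail_eq (h.trans k.le_succ), Nat.sub_self])

/-- The weight of the tableau described by a pattern. -/
noncomputable def weight : ℕ →₀ ℕ := Finsupp.ofSupportFinite _ g.finite_support_weight

theorem weight_apply (k : ℕ) : g.weight k = g.tail 0 (k + 1) - g.tail 0 k := rfl

theorem tail_succ (k : ℕ) : g.tail 0 (k + 1) = g.tail 0 k + g.weight k := by
  rw [weight_apply, Nat.add_sub_of_le (g.tail_mono 0 k.le_succ)]

theorem boundedBy_iff {n : ℕ} : g.BoundedBy n ↔ ∀ k, n ≤ k → g.weight k = 0 := by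
  constructor
  · intro h k hk
    rw [weight_apply, h.tail_eq hk, h.tail_eq (hk.trans k.le_succ), Nat.sub_self]
  · intro h
    obtain ⟨m, hm⟩ : ∃ n, g.BoundedBy n := g.eventually_top
    have key : ∀ d, g.tail 0 (n + d) = g.tail 0 n := by
      intro d
      induction d with
      | zero => rfl
      | succ d ih => rw [← add_assoc, tail_succ, h _ (by omega), ih, add_zero]
    intro k hk i
    by_cases hi : i < μ.colLen 0
    · have h1 : g.tail 0 k = g.tail 0 (max m k) := by
        obtain ⟨d, rfl⟩ := Nat.exists_eq_add_of_le hk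
        obtain ⟨e, he⟩ := Nat.exists_eq_add_of_le (hk.trans (le_max_right m (n + d)))
        rw [he, key, key]
      -- Each row grows with `k`, so equality of the totals forces equality row by row.
      have h2 := (sum_eq_sum_iff_of_le fun i _ =>
        Nat.sub_le_sub_right (g.row_mono i (le_max_right m k)) 0).1 h1 i (mem_range.2 hi)
      simpa [hm _ (le_max_left m k)] using h2
    · rw [g.row_eq_zero (not_lt.1 hi), YoungDiagram.rowLen_eq_zero (not_lt.1 hi)]

instance finite_boundedBy (n : ℕ) : Finite {g : GTPattern μ // g.BoundedBy n} := by
  refine Finite.of_injective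
    (fun g (p : Fin n × Fin (μ.colLen 0)) =>
      (⟨g.1.row p.1 p.2, Nat.lt_succ_of_le (g.1.row_le_rowLen _ _)⟩ :
        Fin (μ.rowLen p.2 + 1))) ?_
  intro g h hgh
  apply Subtype.ext
  ext k i
  by_cases hk : n ≤ k
  · rw [g.2 k hk, h.2 k hk]
  by_cases hi : μ.colLen 0 ≤ i
  · rw [g.1.row_eq_zero hi, h.1.row_eq_zero hi]
  exact congrArg Fin.val (congrFun hgh (⟨k, not_le.1 hk⟩, ⟨i, not_le.1 hi⟩))

end GTPattern

/-! ### The bijection between tableaux and patterns -/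

namespace SemistandardYoungTableau

variable {μ : YoungDiagram} (T : SemistandardYoungTableau μ)

theorem exists_rowCount (k i : ℕ) : ∃ c, c < μ.rowLen i → k ≤ T i c :=
  ⟨μ.rowLen i, fun h => absurd h (lt_irrefl _)⟩

/-- The number of entries `< k` in row `i`. -/
def rowCount (k i : ℕ) : ℕ := Nat.find (T.exists_rowCount k i)

theorem lt_rowCount_iff {k i c : ℕ} : c < T.rowCount k i ↔ c < μ.rowLen i ∧ T i c < k := by
  rw [rowCount, Nat.lt_find_iff]
  constructor
  · intro h
    simpa using h c le_rfl
  · rintro ⟨h1, h2⟩ m hm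
    push Not
    exact ⟨by omega, (T.row_weak_of_le hm (YoungDiagram.mem_iff_lt_rowLen.2 h1)).trans_lt h2⟩

/-- The Gelfand–Tsetlin pattern of a tableau. -/
def toGTPattern : GTPattern μ where
  row := T.rowCount
  row_zero i := by
    by_contra h
    exact absurd (T.lt_rowCount_iff.1 (Nat.pos_of_ne_zero h)).2 (Nat.not_lt_zero _)
  row_le_succ k i := by
    refine le_of_forall_lt fun c hc => ?_
    rw [lt_rowCount_iff] at hc ⊢
    omega
  row_succ_le k i := by
    refine le_of_forall_lt fun c hc => ?_
    rw [lt_rowCount_iff] at hc ⊢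
    have h1 := μ.rowLen_anti i (i + 1) (by omega)
    have h2 := T.col_strict (Nat.lt_add_one i) (YoungDiagram.mem_iff_lt_rowLen.2 hc.1)
    omega
  eventually_top := by
    refine ⟨μ.cells.sup (fun c => T c.1 c.2) + 1, fun k hk i => ?_⟩
    refine eq_of_forall_lt_iff fun c => ?_
    rw [lt_rowCount_iff, and_iff_left_iff_imp]
    intro hc
    have := le_sup (f := fun c : ℕ × ℕ => T c.1 c.2)
      (show (i, c) ∈ μ.cells from YoungDiagram.mem_iff_lt_rowLen.2 hc)
    simp only at this
    omega

theorem tail_toGTPattern (k : ℕ) :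
    T.toGTPattern.tail 0 k = #{c ∈ μ.cells | T c.1 c.2 < k} := by
  rw [card_eq_sum_card_fiberwise (f := Prod.fst) (t := range (μ.colLen 0))]
  · refine sum_congr rfl fun i _ => ?_
    rw [Nat.sub_zero, ← card_range (T.toGTPattern.row k i)]
    refine card_bij (fun c _ => (i, c)) ?_ ?_ ?_
    · intro c hc
      have := T.lt_rowCount_iff.1 (mem_range.1 hc)
      simpa [YoungDiagram.mem_iff_lt_rowLen] using this
    · intro a _ b _ h
      simpa using h
    · rintro ⟨a, b⟩ h
      simp only [mem_filter, YoungDiagram.mem_cells, YoungDiagram.mem_iff_lt_rowLen] at h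
      obtain ⟨⟨h1, h2⟩, rfl⟩ := h
      exact ⟨b, mem_range.2 (T.lt_rowCount_iff.2 ⟨h1, h2⟩), rfl⟩
  · rintro ⟨a, b⟩ h
    simp only [coe_filter, YoungDiagram.mem_cells, Set.mem_ofPred_eq] at h
    exact mem_coe.2 (mem_range.2 (YoungDiagram.mem_iff_lt_colLen.1
      (μ.up_left_mem le_rfl (Nat.zero_le b) h.1)))

theorem weight_toGTPattern : T.toGTPattern.weight = T.weight := by
  ext k
  rw [GTPattern.weight_apply, tail_toGTPattern, tail_toGTPattern, weight,
    Finsupp.finsetSum_apply]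
  simp only [Finsupp.single_apply]
  rw [← card_filter, Nat.sub_eq_iff_eq_add', ← card_union_of_disjoint]
  · congr 1
    ext c
    simp only [mem_filter, mem_union]
    grind
  · rw [disjoint_filter]
    intro c _ h
    omega
  · exact card_le_card (monotone_filter_right _ fun c _ h => Nat.lt_succ_of_lt h)

end SemistandardYoungTableau

namespace GTPattern

variable {μ : YoungDiagram} (g : GTPattern μ)

theorem exists_lt_row {i c : ℕ} (h : c < μ.rowLen i) : ∃ k, c < g.row (k + 1) i := by
  obtain ⟨n, hn⟩ := g.eventually_top
  exact ⟨n, by rwa [hn _ n.le_succ]⟩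

open Classical in
/-- The entry in a box of the tableau described by a pattern. -/
def entry (i c : ℕ) : ℕ :=
  if h : c < μ.rowLen i then Nat.find (g.exists_lt_row h) else 0

theorem entry_lt_iff {i c k : ℕ} (h : c < μ.rowLen i) : g.entry i c < k ↔ c < g.row k i := by
  classical
  rw [entry, dif_pos h, Nat.find_lt_iff]
  constructor
  · rintro ⟨m, hm, h⟩
    exact h.trans_le (g.row_mono i hm)
  · intro h
    cases k with
    | zero => simp [g.row_zero] at h
    | succ k => exact ⟨k, k.lt_succ_self, h⟩

/-- The tableau described by a pattern. -/
def toTableau : SemistandardYoungTableau μ where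
  entry := g.entry
  row_weak' {i j1 j2} hj h := by
    rw [YoungDiagram.mem_iff_lt_rowLen] at h
    refine not_lt.1 fun h1 => ?_
    rw [g.entry_lt_iff h] at h1
    exact lt_irrefl _ ((g.entry_lt_iff (hj.trans h)).2 (hj.trans h1))
  col_strict' {i1 i2 j} hi h := by
    rw [YoungDiagram.mem_iff_lt_rowLen] at h
    have h1 := (g.entry_lt_iff h).1 (Nat.lt_add_one _)
    obtain ⟨d, rfl⟩ := Nat.exists_eq_add_of_lt hi
    rw [g.entry_lt_iff (h.trans_le (μ.rowLen_anti _ _ hi.le))]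
    exact h1.trans_le ((g.row_succ_le _ _).trans (g.row_anti _ (Nat.le_add_right i1 d)))
  zeros' {i j} h := by
    rw [YoungDiagram.mem_iff_lt_rowLen] at h
    exact dif_neg h

theorem toGTPattern_toTableau : g.toTableau.toGTPattern = g := by
  ext k i
  refine eq_of_forall_lt_iff fun c => ?_
  refine (g.toTableau.lt_rowCount_iff).trans ?_
  constructor
  · rintro ⟨h1, h2⟩
    exact (g.entry_lt_iff h1).1 h2
  · intro h
    have h1 := h.trans_le (g.row_le_rowLen k i)
    exact ⟨h1, (g.entry_lt_iff h1).2 h⟩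

end GTPattern

namespace SemistandardYoungTableau

variable {μ : YoungDiagram}

theorem toTableau_toGTPattern (T : SemistandardYoungTableau μ) : T.toGTPattern.toTableau = T := by
  ext i c
  by_cases h : c < μ.rowLen i
  · refine eq_of_forall_gt_iff fun k => ?_
    refine (T.toGTPattern.entry_lt_iff h).trans ?_
    exact T.lt_rowCount_iff.trans (and_iff_right h)
  · have h' : (i, c) ∉ μ := fun h1 => h (YoungDiagram.mem_iff_lt_rowLen.1 h1)
    rw [T.zeros h', T.toGTPattern.toTableau.zeros h']

/-- Tableaux of a given shape correspond to Gelfand–Tsetlin patterns. -/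
def equivGTPattern : SemistandardYoungTableau μ ≃ GTPattern μ where
  toFun := toGTPattern
  invFun := GTPattern.toTableau
  left_inv := toTableau_toGTPattern
  right_inv := GTPattern.toGTPattern_toTableau

theorem card_weight_eq (μ : YoungDiagram) (α : ℕ →₀ ℕ) :
    Nat.card {T : SemistandardYoungTableau μ // T.weight = α} =
      Nat.card {g : GTPattern μ // g.weight = α} :=
  Nat.card_congr (equivGTPattern.subtypeEquiv fun T => by
    rw [← T.weight_toGTPattern]; rfl)

end SemistandardYoungTableau

/-! ### Bender–Knuth toggles truncated to the columns left of `j` -/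

namespace GTPattern

/-- The Bender–Knuth toggle of a row `q` between the rows `p` and `r` of a Gelfand–Tsetlin
pattern, restricted to the columns `< j`. -/
def toggleRow (p q r : ℕ → ℕ) (j : ℕ) : ℕ → ℕ
  -- The top row has no row above it, so the upper bound `p (i - 1)` is absent.
  | 0 => if j < q 0 then q 0 else min (r 0) j + max (p 0) (r 1) - q 0
  | i + 1 => if j < q (i + 1) then q (i + 1) else
      min (min (r (i + 1)) (p i)) j + max (p (i + 1)) (r (i + 1 + 1)) - q (i + 1)

section toggleRow

variable {p q r : ℕ → ℕ} (hpq : ∀ i, p i ≤ q i) (hqr : ∀ i, q i ≤ r i)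
  (hqp : ∀ i, q (i + 1) ≤ p i) (hrq : ∀ i, r (i + 1) ≤ q i) (j : ℕ)

include hpq hqr hqp hrq

theorem toggleRow_bounds (i : ℕ) :
    p i ≤ toggleRow p q r j i ∧ toggleRow p q r j i ≤ r i ∧
      r (i + 1) ≤ toggleRow p q r j i ∧ toggleRow p q r j (i + 1) ≤ p i := by
  have h1 := hpq i
  have h2 := hqr i
  have h3 := hqp i
  have h4 := hrq i
  have h5 := hrq (i + 1)
  have h6 := hpq (i + 1)
  have h7 := hqr (i + 1)
  cases i with
  | zero =>
    simp only [toggleRow, zero_add] at *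
    split_ifs <;> omega
  | succ i =>
    have h8 := hqp i
    simp only [toggleRow] at *
    split_ifs <;> omega

omit hqr hqp in
theorem toggleRow_le_iff (i : ℕ) :
    (j < q i ∧ toggleRow p q r j i = q i) ∨ (q i ≤ j ∧ toggleRow p q r j i ≤ j) := by
  have h1 := hpq i
  have h4 := hrq i
  cases i with
  | zero =>
    simp only [toggleRow, zero_add] at *
    split_ifs <;> omega
  | succ i =>
    simp only [toggleRow] at *
    split_ifs <;> omega

theorem toggleRow_toggleRow (i : ℕ) : toggleRow p (toggleRow p q r j) r j i = q i := by
  have h1 := hpq i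
  have h2 := hqr i
  have h4 := hrq i
  have h := toggleRow_le_iff hpq hrq j i
  cases i with
  | zero =>
    simp only [toggleRow, zero_add] at *
    split_ifs at * <;> omega
  | succ i =>
    have h8 := hqp i
    simp only [toggleRow] at *
    split_ifs at * <;> omega

/-- The sum telescopes because min + max of `p i` and `r (i + 1)` is their sum. The hypothesis says
that column `j` has no entry `k`, so a row left alone because `j < q i` has no `k` in the columns `<
j` either. -/
theorem sum_min_toggleRow (hj : ∀ i, j < q i → j < p i) (m : ℕ) :
    ∑ i ∈ range (m + 1), (min (toggleRow p q r j i) j + min (q i) j) + min (p m) j =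
      ∑ i ∈ range (m + 1), (min (p i) j + min (r i) j) +
        max (min (p m) j) (min (r (m + 1)) j) := by
  induction m with
  | zero =>
    have h1 := hpq 0
    have h2 := hqr 0
    have h4 := hrq 0
    have h5 := hj 0
    simp only [zero_add, sum_range_one, toggleRow] at *
    split_ifs <;> omega
  | succ m ih =>
    rw [sum_range_succ, sum_range_succ (fun i => min (p i) j + min (r i) j)]
    have h1 := hpq (m + 1)
    have h2 := hqr (m + 1)
    have h3 := hqp m
    have h4 := hrq (m + 1)
    have h5 := hj (m + 1)
    have h6 : min (toggleRow p q r j (m + 1)) j + min (q (m + 1)) j + min (p (m + 1)) j +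
        max (min (p m) j) (min (r (m + 1)) j) =
        min (p m) j + min (p (m + 1)) j + min (r (m + 1)) j +
        max (min (p (m + 1)) j) (min (r (m + 1 + 1)) j) := by
      simp only [toggleRow]
      split_ifs <;> omega
    omega

end toggleRow

variable {μ : YoungDiagram} (g : GTPattern μ)

/-- The Bender–Knuth toggle of the number of entries `≤ k`, restricted to the columns `< j`. -/
def toggle (j k : ℕ) : GTPattern μ where
  row := Function.update g.row (k + 1)
    (toggleRow (g.row k) (g.row (k + 1)) (g.row (k + 1 + 1)) j)
  row_zero i := by simp [g.row_zero]
  row_le_succ l i := by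
    have h := toggleRow_bounds (g.row_le_succ k) (g.row_le_succ (k + 1)) (g.row_succ_le k)
      (g.row_succ_le (k + 1)) j i
    have h1 := g.row_le_succ l i
    simp only [Function.update_apply]
    split_ifs with h2 h3 h3
    · omega
    · subst h2; exact h.2.1
    · obtain rfl : l = k := by omega
      exact h.1
    · exact h1
  row_succ_le l i := by
    have h := toggleRow_bounds (g.row_le_succ k) (g.row_le_succ (k + 1)) (g.row_succ_le k)
      (g.row_succ_le (k + 1)) j i
    have h1 := g.row_succ_le l i
    simp only [Function.update_apply]
    split_ifs with h2 h3 h3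
    · omega
    · obtain rfl : l = k := by omega
      exact h.2.2.2
    · subst h3; exact h.2.2.1
    · exact h1
  eventually_top := by
    obtain ⟨n, hn⟩ := g.eventually_top
    refine ⟨max n (k + 1 + 1), fun l hl i => ?_⟩
    rw [Function.update_of_ne (by omega), hn l (by omega)]

theorem toggle_row_of_ne (j : ℕ) {k l : ℕ} (h : l ≠ k + 1) : (g.toggle j k).row l = g.row l :=
  Function.update_of_ne h _ _

theorem toggle_row_self (j k : ℕ) : (g.toggle j k).row (k + 1) =
    toggleRow (g.row k) (g.row (k + 1)) (g.row (k + 1 + 1)) j :=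
  Function.update_self _ _ _

theorem toggle_toggle (j k : ℕ) : (g.toggle j k).toggle j k = g := by
  ext l i
  by_cases h : l = k + 1
  · subst h
    rw [toggle_row_self, toggle_row_self, toggle_row_of_ne _ _ (by omega),
      toggle_row_of_ne _ _ (by omega)]
    exact toggleRow_toggleRow (g.row_le_succ k) (g.row_le_succ (k + 1)) (g.row_succ_le k)
      (g.row_succ_le (k + 1)) j i
  · rw [toggle_row_of_ne _ _ h, toggle_row_of_ne _ _ h]

theorem BoundedBy.toggle {g : GTPattern μ} {n k : ℕ} (h : g.BoundedBy n) (hk : k + 1 < n)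
    (j : ℕ) : (g.toggle j k).BoundedBy n := fun l hl i => by
  rw [toggle_row_of_ne _ _ (by omega), h l hl]

theorem tail_toggle_of_ne (j : ℕ) {k l : ℕ} (h : l ≠ k + 1) (j' : ℕ) :
    (g.toggle j k).tail j' l = g.tail j' l := by
  rw [tail, tail, toggle_row_of_ne _ _ h]

theorem tail_toggle_of_le (k : ℕ) {j j' : ℕ} (h : j ≤ j') (l : ℕ) :
    (g.toggle j k).tail j' l = g.tail j' l := by
  by_cases hl : l = k + 1
  · subst hl
    refine sum_congr rfl fun i _ => ?_
    have := toggleRow_le_iff (g.row_le_succ k) (g.row_succ_le (k + 1)) j i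
    rw [toggle_row_self]
    omega
  · exact g.tail_toggle_of_ne j hl j'

theorem tail_zero_eq (j k : ℕ) :
    g.tail 0 k = ∑ i ∈ range (μ.colLen 0), min (g.row k i) j + g.tail j k := by
  rw [tail, tail, ← sum_add_distrib]
  exact sum_congr rfl fun i _ => by omega

theorem tail_toggle_self {j k : ℕ} (hj : ∀ i, j < g.row (k + 1) i → j < g.row k i) :
    (g.toggle j k).tail 0 (k + 1) + g.tail 0 (k + 1) + g.tail j k + g.tail j (k + 1 + 1) =
      g.tail 0 k + g.tail 0 (k + 1 + 1) + 2 * g.tail j (k + 1) := by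
  rw [tail_zero_eq _ j, g.tail_zero_eq j (k + 1), g.tail_zero_eq j k, g.tail_zero_eq j (k + 1 + 1),
    g.tail_toggle_of_le k le_rfl, toggle_row_self]
  have h : ∑ i ∈ range (μ.colLen 0),
      (min (toggleRow (g.row k) (g.row (k + 1)) (g.row (k + 1 + 1)) j i) j + min (g.row (k + 1) i) j) =
      ∑ i ∈ range (μ.colLen 0), (min (g.row k i) j + min (g.row (k + 1 + 1) i) j) := by
    rcases h : μ.colLen 0 with _ | m
    · rfl
    have := sum_min_toggleRow (g.row_le_succ k) (g.row_le_succ (k + 1)) (g.row_succ_le k)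
      (g.row_succ_le (k + 1)) j hj m
    rw [g.row_eq_zero (h.le : _ ≤ m + 1)] at this
    omega
  rw [sum_add_distrib, sum_add_distrib] at h
  omega

theorem weight_toggle_of_ne (j : ℕ) {k l : ℕ} (h1 : l ≠ k) (h2 : l ≠ k + 1) :
    (g.toggle j k).weight l = g.weight l := by
  rw [weight_apply, weight_apply, tail_toggle_of_ne _ _ (by omega), tail_toggle_of_ne _ _ h2]

/-- The numbers of `k` and `k + 1` in the columns `< j` are exchanged while the columns `≥ j` are
kept; the tails record the kept part, arranged to avoid subtraction. -/
theorem weight_toggle {j k : ℕ} (hj : ∀ i, j < g.row (k + 1) i → j < g.row k i) :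
    (g.toggle j k).weight k + g.tail j k + g.tail j (k + 1 + 1) =
        g.weight (k + 1) + 2 * g.tail j (k + 1) ∧
      (g.toggle j k).weight (k + 1) + 2 * g.tail j (k + 1) =
        g.weight k + g.tail j k + g.tail j (k + 1 + 1) := by
  have h := g.tail_toggle_self hj
  have h1 := (g.toggle j k).tail_succ k
  have h2 := (g.toggle j k).tail_succ (k + 1)
  have h3 := g.tail_succ k
  have h4 := g.tail_succ (k + 1)
  rw [tail_toggle_of_ne (l := k) _ _ (by omega)] at h1
  rw [tail_toggle_of_ne (l := k + 1 + 1) _ _ (by omega)] at h2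
  omega

theorem tail_rowLen_zero (k : ℕ) {j : ℕ} (hj : μ.rowLen 0 ≤ j) : g.tail j k = 0 :=
  sum_eq_zero fun i _ => Nat.sub_eq_zero_of_le
    ((g.row_le_rowLen k i).trans ((μ.rowLen_anti 0 i i.zero_le).trans hj))

/-! ### The Littlewood–Richardson condition and its first violation -/

/-- The weight of the columns `≥ j` of the tableau, added to `lam`, increases from `k` to
`k + 1`. -/
def Violates (lam : ℕ → ℕ) (j k : ℕ) : Prop :=
  lam k + 2 * g.tail j (k + 1) < lam (k + 1) + g.tail j (k + 1 + 1) + g.tail j k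

/-- Littlewood–Richardson patterns: for every `j` the weight of the columns `≥ j` of the tableau
yields a partition when added to `lam`. -/
def IsLR (lam : ℕ → ℕ) : Prop := ∀ j k, ¬ g.Violates lam j k

/-- The number of entries `< k` in column `j`. -/
def colCount (j k : ℕ) : ℕ := #{i ∈ range (μ.colLen 0) | j < g.row k i}

theorem tail_eq_tail_succ_add (j k : ℕ) : g.tail j k = g.tail (j + 1) k + g.colCount j k := by
  rw [tail, tail, colCount, card_filter, ← sum_add_distrib]
  refine sum_congr rfl fun i _ => ?_
  split_ifs <;> omega

theorem filter_row_subset (j k : ℕ) : {i ∈ range (μ.colLen 0) | j < g.row k i} ⊆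
    {i ∈ range (μ.colLen 0) | j < g.row (k + 1) i} :=
  monotone_filter_right _ fun i _ h => h.trans_le (g.row_le_succ k i)

/-- Columns are strict, so an entry `k` occurs at most once in column `j`. -/
theorem colCount_succ_le (j k : ℕ) : g.colCount j (k + 1) ≤ g.colCount j k + 1 := by
  have h : {i ∈ range (μ.colLen 0) | j < g.row (k + 1) i} ⊆
      insert 0 ({i ∈ range (μ.colLen 0) | j < g.row k i}.image Nat.succ) := by
    intro i hi
    rw [mem_filter, mem_range] at hi
    cases i with
    | zero => exact mem_insert_self _ _
    | succ i =>
      refine mem_insert_of_mem (mem_image_of_mem _ (mem_filter.2 ⟨mem_range.2 (by omega), ?_⟩))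
      exact hi.2.trans_le (g.row_succ_le k i)
  exact (card_le_card h).trans ((card_insert_le _ _).trans (Nat.succ_le_succ card_image_le))

/-- Adding column `j` changes each count by at most one. A new violation therefore has deficit
exactly 1, and column `j` contains `k + 1` but not `k`; the latter is what the truncated toggle
needs. -/
theorem Violates.step {g : GTPattern μ} {lam : ℕ → ℕ} {j k : ℕ} (h : g.Violates lam j k)
    (h' : ¬ g.Violates lam (j + 1) k) :
    lam k + 2 * g.tail j (k + 1) + 1 = lam (k + 1) + g.tail j (k + 1 + 1) + g.tail j k ∧
      ∀ i, j < g.row (k + 1) i → j < g.row k i := by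
  have h1 := g.tail_eq_tail_succ_add j k
  have h2 := g.tail_eq_tail_succ_add j (k + 1)
  have h3 := g.tail_eq_tail_succ_add j (k + 1 + 1)
  have h4 := g.colCount_succ_le j (k + 1)
  have h5 : g.colCount j k ≤ g.colCount j (k + 1) := card_le_card (g.filter_row_subset j k)
  rw [Violates] at h h'
  have h6 : g.colCount j (k + 1) ≤ g.colCount j k := by omega
  refine ⟨by omega, fun i hi => ?_⟩
  have h7 : i ∈ {i ∈ range (μ.colLen 0) | j < g.row (k + 1) i} := by
    refine mem_filter.2 ⟨mem_range.2 ?_, hi⟩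
    by_contra h0
    rw [g.row_eq_zero (not_lt.1 h0)] at hi
    exact Nat.not_lt_zero _ hi
  rw [← eq_of_subset_of_card_le (g.filter_row_subset j k) h6] at h7
  exact (mem_filter.1 h7).2

theorem BoundedBy.lt_of_violates {g : GTPattern μ} {n : ℕ} (hg : g.BoundedBy n) {lam : ℕ → ℕ}
    (hlam : Antitone lam) {j k : ℕ} (h : g.Violates lam j k) : k + 1 < n := by
  by_contra hk
  rw [Violates, hg.tail_eq (by omega : n ≤ k + 1), hg.tail_eq (by omega : n ≤ k + 1 + 1),
    ← hg.tail_eq (by omega : n ≤ k + 1)] at h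
  have h1 := g.tail_mono j (by omega : k ≤ k + 1)
  have h2 := hlam (by omega : k ≤ k + 1)
  omega

/-- `(j, k)` is the first violation of the Littlewood–Richardson condition, the columns being read
from right to left. -/
def FirstViolation (lam : ℕ → ℕ) (x : ℕ × ℕ) : Prop :=
  (∀ j k, x.1 < j → ¬ g.Violates lam j k) ∧ g.Violates lam x.1 x.2 ∧
    ∀ k < x.2, ¬ g.Violates lam x.1 k

theorem FirstViolation.unique {g : GTPattern μ} {lam : ℕ → ℕ} {x y : ℕ × ℕ}
    (hx : g.FirstViolation lam x) (hy : g.FirstViolation lam y) : x = y := by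
  have h1 : x.1 = y.1 := le_antisymm (not_lt.1 fun h => hy.1 _ _ h hx.2.1)
    (not_lt.1 fun h => hx.1 _ _ h hy.2.1)
  refine Prod.ext h1 (le_antisymm (not_lt.1 fun h => ?_) (not_lt.1 fun h => ?_))
  · exact hx.2.2 _ h (h1 ▸ hy.2.1)
  · exact hy.2.2 _ h (h1 ▸ hx.2.1)

theorem exists_firstViolation {g : GTPattern μ} {lam : ℕ → ℕ} (hlam : Antitone lam)
    (h : ¬ g.IsLR lam) : ∃ x, g.FirstViolation lam x := by
  classical
  have h1 : ∃ N, ∀ j k, N ≤ j → ¬ g.Violates lam j k := by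
    refine ⟨μ.rowLen 0, fun j k hj => ?_⟩
    rw [Violates, tail_rowLen_zero _ _ hj, tail_rowLen_zero _ _ hj, tail_rowLen_zero _ _ hj]
    have := hlam (by omega : k ≤ k + 1)
    omega
  have h2 := Nat.find_spec h1
  rcases hN : Nat.find h1 with _ | j
  · exact absurd (fun j k => h2 j k (hN ▸ j.zero_le)) h
  have h3 := Nat.find_min h1 (hN ▸ j.lt_add_one : j < _)
  rw [hN] at h2
  push Not at h3
  obtain ⟨j', k', hj, hv⟩ := h3
  obtain rfl : j' = j := le_antisymm (not_lt.1 fun h => h2 _ _ h hv) hj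
  have h4 : ∃ k, g.Violates lam j' k := ⟨k', hv⟩
  exact ⟨(j', Nat.find h4), h2, Nat.find_spec h4, fun k hk => Nat.find_min h4 hk⟩

theorem violates_toggle_iff {lam : ℕ → ℕ} {j j' : ℕ} (h : j ≤ j') (k l : ℕ) :
    (g.toggle j k).Violates lam j' l ↔ g.Violates lam j' l := by
  simp only [Violates, g.tail_toggle_of_le k h]

/-- Being first concerns only columns `≥ x.1`, which the toggle does not touch. This makes the
reflection an involution. -/
theorem FirstViolation.toggle {g : GTPattern μ} {lam : ℕ → ℕ} {x : ℕ × ℕ}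
    (hx : g.FirstViolation lam x) : (g.toggle x.1 x.2).FirstViolation lam x := by
  refine ⟨fun j k h => ?_, ?_, fun k h => ?_⟩
  · rw [violates_toggle_iff _ h.le]
    exact hx.1 j k h
  · rw [violates_toggle_iff _ le_rfl]
    exact hx.2.1
  · rw [violates_toggle_iff _ le_rfl]
    exact hx.2.2 k h

theorem IsLR.antitone_add_weight {g : GTPattern μ} {lam : ℕ → ℕ} (h : g.IsLR lam) :
    Antitone fun k => lam k + g.weight k := by
  refine antitone_nat_of_succ_le fun k => ?_
  have h1 := h 0 k
  have h2 := g.tail_succ k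
  have h3 := g.tail_succ (k + 1)
  rw [Violates] at h1
  omega

theorem isLR_of_forall_add_weight_le {lam : ℕ → ℕ}
    (h : ∀ k, lam (k + 1) + g.weight (k + 1) ≤ lam k) : g.IsLR lam := by
  intro j k
  have h1 := h k
  have h2 := g.tail_mono j (by omega : k ≤ k + 1)
  have h3 : g.tail j (k + 1 + 1) ≤ g.tail j (k + 1) + g.weight (k + 1) := by
    rw [weight_apply, tail, tail, tail, tail, ← sum_tsub_distrib _ fun i _ => by
      simpa using g.row_le_succ (k + 1) i, ← sum_add_distrib]
    exact sum_le_sum fun i _ => by omega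
  rw [Violates]
  omega

/-! ### The highest weight pattern -/

/-- The pattern of the tableau in which all entries of row `i` are equal to `i`. -/
def highest (μ : YoungDiagram) : GTPattern μ where
  row k i := if i < k then μ.rowLen i else 0
  row_zero i := rfl
  row_le_succ k i := by split_ifs <;> omega
  row_succ_le k i := by
    have := μ.rowLen_anti i (i + 1) (by omega)
    split_ifs <;> omega
  eventually_top := by
    refine ⟨μ.colLen 0, fun k hk i => ?_⟩
    split_ifs with h
    · rfl
    · rw [YoungDiagram.rowLen_eq_zero (by omega)]

theorem tail_highest_succ (j k : ℕ) :
    (highest μ).tail j (k + 1) = (highest μ).tail j k + (μ.rowLen k - j) := by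
  have h : ∀ i, (highest μ).row (k + 1) i - j =
      ((highest μ).row k i - j) + if i = k then μ.rowLen k - j else 0 := by
    intro i
    simp only [highest]
    split_ifs <;> first | omega | (subst_vars; omega)
  rw [tail, sum_congr rfl fun i _ => h i, sum_add_distrib, sum_ite_eq', tail]
  split_ifs with hk
  · rfl
  · rw [YoungDiagram.rowLen_eq_zero (by simpa using hk), Nat.zero_sub]

theorem weight_highest (k : ℕ) : (highest μ).weight k = μ.rowLen k := by
  rw [weight_apply, tail_highest_succ, Nat.sub_zero, Nat.add_sub_cancel_left]

theorem boundedBy_highest {n : ℕ} (h : μ.colLen 0 ≤ n) : (highest μ).BoundedBy n := by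
  rw [boundedBy_iff]
  intro k hk
  rw [weight_highest, YoungDiagram.rowLen_eq_zero (h.trans hk)]

theorem isLR_zero_iff : g.IsLR 0 ↔ g = highest μ := by
  constructor
  · intro h
    have hz : ∀ k i, k ≤ i → g.row k i = 0 := by
      intro k
      induction k with
      | zero => exact fun i _ => g.row_zero i
      | succ k ih =>
        intro i hi
        obtain ⟨i, rfl⟩ : ∃ m, i = m + 1 := ⟨i - 1, by omega⟩
        exact Nat.le_zero.1 ((g.row_succ_le k i).trans (ih i (by omega)).le)
    have key : ∀ i, g.row (i + 1) i = μ.rowLen i := by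
      intro i
      induction i using Nat.strong_induction_on with
      | _ i ih =>
      by_contra hne
      have hlt : g.row (i + 1) i < μ.rowLen i := lt_of_le_of_ne (g.row_le_rowLen _ _) hne
      have hi : i < μ.colLen 0 := by
        by_contra h0
        rw [YoungDiagram.rowLen_eq_zero (not_lt.1 h0)] at hlt
        omega
      have h0 : ∀ i' < i, ∀ k, i ≤ k → g.row k i' = μ.rowLen i' := fun i' hi' k hk =>
        le_antisymm (g.row_le_rowLen _ _)
          ((ih i' hi').ge.trans (g.row_mono i' (by omega : i' + 1 ≤ k)))
      -- Test the condition at the last column of row `i`. The rows above are already constant, so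
      -- no entry `i` lies in columns `≥ j`; by the condition no larger entry does either, yet the
      -- last box of row `i` holds one.
      set j := μ.rowLen i - 1 with hj
      have h1 : g.tail j (i + 1) ≤ g.tail j i := by
        refine sum_le_sum fun i' _ => ?_
        rcases lt_trichotomy i' i with h2 | h2 | h2
        · rw [h0 i' h2 _ le_rfl, h0 i' h2 _ (Nat.le_succ i)]
        · subst h2; omega
        · rw [hz _ _ (by omega)]; omega
      have h2 : ∀ d, g.tail j (i + d + 1) ≤ g.tail j (i + d) := by
        intro d
        induction d with
        | zero => exact h1
        | succ d ihd =>
          have := h j (i + d)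
          simp only [Violates, Pi.zero_apply] at this
          rw [← add_assoc]
          omega
      have h3 : ∀ d, g.tail j (i + d) ≤ g.tail j i := by
        intro d
        induction d with
        | zero => rfl
        | succ d ihd => exact (h2 d).trans ihd
      obtain ⟨n, hn⟩ := g.eventually_top
      have h4 : g.tail j i < g.tail j (i + n) := by
        refine sum_lt_sum (fun i' _ => Nat.sub_le_sub_right (g.row_mono i' (by omega)) j)
          ⟨i, mem_range.2 hi, ?_⟩
        rw [hz i i le_rfl, hn (i + n) (by omega)]
        omega
      exact absurd (h3 n) (not_le.2 h4)
    ext k i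
    simp only [highest]
    split_ifs with hik
    · exact le_antisymm (g.row_le_rowLen _ _) ((key i).ge.trans (g.row_mono i hik))
    · exact hz k i (not_lt.1 hik)
  · rintro rfl j k
    have h1 := tail_highest_succ (μ := μ) j k
    have h2 := tail_highest_succ (μ := μ) j (k + 1)
    have h3 := μ.rowLen_anti k (k + 1) (by omega)
    simp only [Violates, Pi.zero_apply]
    omega

end GTPattern

/-! ### Finite permutations of the variables and alternants -/

namespace Equiv.Perm

/-- A permutation of the first `n` natural numbers, as a permutation of `ℕ`. -/
def ofFin (n : ℕ) : Equiv.Perm (Fin n) →* Equiv.Perm ℕ :=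
  Equiv.Perm.extendDomainHom Fin.equivSubtype

theorem ofFin_apply {n : ℕ} (σ : Equiv.Perm (Fin n)) (x : Fin n) : ofFin n σ x = σ x :=
  Equiv.Perm.extendDomain_apply_image σ Fin.equivSubtype x

theorem ofFin_apply_of_le {n : ℕ} (σ : Equiv.Perm (Fin n)) {k : ℕ} (h : n ≤ k) :
    ofFin n σ k = k :=
  Equiv.Perm.extendDomain_apply_not_subtype σ Fin.equivSubtype (not_lt.2 h)

theorem ofFin_swap {n : ℕ} (x y : Fin n) :
    ofFin n (Equiv.swap x y) = Equiv.swap (x : ℕ) (y : ℕ) := by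
  ext k
  by_cases h : k < n
  · have h1 := ofFin_apply (Equiv.swap x y) ⟨k, h⟩
    rw [h1]
    simp only [Equiv.swap_apply_def, Fin.ext_iff]
    split_ifs <;> rfl
  · rw [ofFin_apply_of_le _ (not_lt.1 h), Equiv.swap_apply_of_ne_of_ne] <;> omega

end Equiv.Perm

namespace MvPolynomial

open Equiv.Perm (ofFin ofFin_apply ofFin_swap sign)

/-- Antisymmetrization in the first `n` variables. -/
noncomputable def alternant (n : ℕ) : MvPolynomial ℕ ℤ →ₗ[ℤ] MvPolynomial ℕ ℤ :=
  ∑ σ : Equiv.Perm (Fin n), ((sign σ : ℤˣ) : ℤ) • (rename (ofFin n σ)).toLinearMap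

theorem alternant_apply (n : ℕ) (f : MvPolynomial ℕ ℤ) : alternant n f =
    ∑ σ : Equiv.Perm (Fin n), ((sign σ : ℤˣ) : ℤ) • rename (ofFin n σ) f := by
  simp [alternant]

theorem alternant_mul {n : ℕ} (f : MvPolynomial ℕ ℤ) {s : MvPolynomial ℕ ℤ}
    (hs : ∀ σ, rename (ofFin n σ) s = s) : alternant n (f * s) = alternant n f * s := by
  rw [alternant_apply, alternant_apply, sum_mul]
  exact sum_congr rfl fun σ _ => by rw [map_mul, hs, smul_mul_assoc]

theorem alternant_rename {n : ℕ} (f : MvPolynomial ℕ ℤ) (τ : Equiv.Perm (Fin n)) :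
    alternant n (rename (ofFin n τ) f) = ((sign τ : ℤˣ) : ℤ) • alternant n f := by
  rw [alternant_apply, alternant_apply, smul_sum]
  refine Fintype.sum_equiv (Equiv.mulRight τ) _ _ fun σ => ?_
  rw [rename_rename, Equiv.coe_mulRight, map_mul, map_mul, smul_smul, Equiv.Perm.coe_mul,
    ← Units.val_mul, mul_left_comm, Int.units_mul_self, mul_one]

theorem alternant_rename_swap {n k : ℕ} (hk : k + 1 < n) (f : MvPolynomial ℕ ℤ) :
    alternant n (rename (Equiv.swap k (k + 1)) f) = -alternant n f := by
  have h := alternant_rename f (Equiv.swap (⟨k, by omega⟩ : Fin n) ⟨k + 1, hk⟩)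
  rw [ofFin_swap, Equiv.Perm.sign_swap (by simp)] at h
  simpa using h

theorem rename_ofFin_eq {n : ℕ} {s : MvPolynomial ℕ ℤ}
    (hs : ∀ k, k + 1 < n → rename (Equiv.swap k (k + 1)) s = s) (σ : Equiv.Perm (Fin n)) :
    rename (ofFin n σ) s = s := by
  cases n with
  | zero => rw [Subsingleton.elim σ 1, map_one, Equiv.Perm.coe_one, rename_id_apply]
  | succ n =>
    have h : σ ∈ Submonoid.closure (Set.range fun i : Fin n ↦ Equiv.swap i.castSucc i.succ) := by
      rw [Equiv.Perm.mclosure_swap_castSucc_succ]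
      trivial
    induction h using Submonoid.closure_induction with
    | mem x hx =>
      obtain ⟨i, rfl⟩ := hx
      rw [ofFin_swap]
      exact hs i (by omega)
    | one => rw [map_one, Equiv.Perm.coe_one, rename_id_apply]
    | mul x y _ _ hx hy =>
      rw [map_mul, Equiv.Perm.coe_mul, ← rename_rename, hy, hx]

/-- A permutation carrying one strictly decreasing sequence to another is increasing, hence the
identity. -/
theorem coeff_alternant_monomial {n : ℕ} {α β : ℕ →₀ ℕ}
    (hα : StrictAnti fun x : Fin n => α x) (hβ : StrictAnti fun x : Fin n => β x) :
    coeff β (alternant n (monomial α 1)) = if α = β then 1 else 0 := by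
  rw [alternant_apply, coeff_sum, sum_eq_single_of_mem 1 (mem_univ _)]
  · simp [coeff_monomial]
  · intro σ _ hσ
    rw [coeff_smul, rename_monomial, coeff_monomial, if_neg, smul_zero]
    intro h
    refine hσ ?_
    have h1 : ∀ x, β (σ x) = α x := by
      intro x
      rw [← h, ← ofFin_apply, Finsupp.mapDomain_equiv_apply, Equiv.symm_apply_apply]
    have h2 : StrictMono σ := fun x y hxy => by
      have h3 : α y < α x := hα hxy
      rw [← h1, ← h1] at h3
      exact hβ.lt_iff_gt.1 h3
    have h4 : (h2.orderIsoOfSurjective σ σ.surjective) = OrderIso.refl _ := Subsingleton.elim _ _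
    ext x
    exact congrArg Fin.val (DFunLike.congr_fun h4 x)

end MvPolynomial

/-! ### Schur polynomials and the sign-reversing involution -/

namespace GTPattern

open MvPolynomial

variable {μ : YoungDiagram}

noncomputable instance (n : ℕ) : Fintype {g : GTPattern μ // g.BoundedBy n} := Fintype.ofFinite _

/-- The weight `(n, n - 1, …, 1)`. -/
noncomputable def rho (n : ℕ) : ℕ →₀ ℕ :=
  Finsupp.onFinset (range n) (fun k => n - k) fun k hk => mem_range.2 (by omega)

theorem rho_apply (n k : ℕ) : rho n k = n - k := rfl

theorem strictAnti_add_rho {n : ℕ} {α : ℕ →₀ ℕ} (hα : Antitone α) :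
    StrictAnti fun x : Fin n => (α + rho n) x := by
  intro x y hxy
  have h := hα (Fin.le_def.1 hxy.le)
  have := y.2
  simp only [Finsupp.add_apply, rho_apply]
  omega

theorem mapDomain_swap {α β : ℕ →₀ ℕ} {k : ℕ} (h1 : β k = α (k + 1)) (h2 : β (k + 1) = α k)
    (h3 : ∀ l, l ≠ k → l ≠ k + 1 → β l = α l) : α.mapDomain (Equiv.swap k (k + 1)) = β := by
  ext l
  rw [Finsupp.mapDomain_equiv_apply, Equiv.symm_swap, Equiv.swap_apply_def]
  split_ifs with h h'
  · rw [h, h1]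
  · rw [h', h2]
  · rw [h3 l h h']

variable (μ) in
/-- The Schur polynomial of `μ` in the first `n` variables. -/
noncomputable def schurPoly (n : ℕ) : MvPolynomial ℕ ℤ :=
  ∑ g : {g : GTPattern μ // g.BoundedBy n}, monomial g.1.weight 1

theorem coeff_schurPoly {n : ℕ} {α : ℕ →₀ ℕ} (hα : ∀ k, n ≤ k → α k = 0) :
    coeff α (schurPoly μ n) = μ.schur α := by
  classical
  have h1 : μ.schur α = (Nat.card {g : GTPattern μ // g.weight = α} : ℤ) := by
    rw [← SemistandardYoungTableau.card_weight_eq]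
    rfl
  rw [h1, schurPoly, coeff_sum]
  simp only [coeff_monomial]
  rw [sum_boole, ← Fintype.card_subtype, ← Nat.card_eq_fintype_card]
  refine congrArg _ (Nat.card_congr (Equiv.subtypeSubtypeEquivSubtype
    (p := fun g : GTPattern μ => g.BoundedBy n) (q := fun g => g.weight = α)
    fun {g} hg => ?_))
  exact g.boundedBy_iff.2 fun k hk => by rw [hg, hα k hk]

theorem coeff_schurPoly_of_ne {n k : ℕ} {α : ℕ →₀ ℕ} (hk : n ≤ k) (hα : α k ≠ 0) :
    coeff α (schurPoly μ n) = 0 := by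
  rw [schurPoly, coeff_sum]
  refine sum_eq_zero fun g _ => ?_
  rw [coeff_monomial, if_neg]
  rintro rfl
  exact hα (g.1.boundedBy_iff.1 g.2 k hk)

theorem rename_swap_schurPoly {n k : ℕ} (hk : k + 1 < n) :
    rename (Equiv.swap k (k + 1)) (schurPoly μ n) = schurPoly μ n := by
  -- Truncating at `μ.rowLen 0` truncates nothing: this is the classical Bender–Knuth involution.
  have hinv : Function.Involutive fun g : {g : GTPattern μ // g.BoundedBy n} =>
      (⟨g.1.toggle (μ.rowLen 0) k, g.2.toggle hk _⟩ : {g : GTPattern μ // g.BoundedBy n}) :=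
    fun g => Subtype.ext (g.1.toggle_toggle _ _)
  rw [schurPoly, map_sum]
  refine Fintype.sum_equiv hinv.toPerm _ _ fun ⟨g, _⟩ => ?_
  rw [rename_monomial]
  refine congrArg (fun α => monomial α (1 : ℤ)) ?_
  have h := g.weight_toggle (j := μ.rowLen 0) (k := k) fun i hi => by
    have h1 := g.row_le_rowLen (k + 1) i
    have h2 := μ.rowLen_anti 0 i i.zero_le
    omega
  simp only [tail_rowLen_zero _ _ le_rfl] at h
  refine mapDomain_swap ?_ ?_ fun l h1 h2 => g.weight_toggle_of_ne _ h1 h2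
  · exact h.1
  · exact h.2

/-- The deficit 1 is compensated by the unit drop of `rho`: the contributions of `lam`, `rho` and
the columns `≥ x.1` agree at `x.2` and `x.2 + 1`, and the toggle swaps the rest. The exponent is
thus transposed. -/
theorem FirstViolation.alternant_toggle {g : GTPattern μ} {lam : ℕ →₀ ℕ} {x : ℕ × ℕ}
    (hx : g.FirstViolation lam x) {n : ℕ} (hn : x.2 + 1 < n) :
    alternant n (monomial (lam + (g.toggle x.1 x.2).weight + rho n) 1) =
      -alternant n (monomial (lam + g.weight + rho n) 1) := by
  obtain ⟨h1, h2⟩ := hx.2.1.step (hx.1 _ _ (Nat.lt_succ_self _))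
  obtain ⟨h3, h4⟩ := g.weight_toggle h2
  rw [← alternant_rename_swap hn, rename_monomial, mapDomain_swap]
  · simp only [Finsupp.add_apply, rho_apply]
    omega
  · simp only [Finsupp.add_apply, rho_apply]
    omega
  · intro l hl hl'
    simp only [Finsupp.add_apply, g.weight_toggle_of_ne _ hl hl']

open Classical in
/-- The sign reversing involution on the patterns that are not Littlewood–Richardson. -/
noncomputable def reflect (lam : ℕ → ℕ) (g : GTPattern μ) : GTPattern μ :=
  if h : ∃ x, g.FirstViolation lam x then g.toggle h.choose.1 h.choose.2 else g

theorem FirstViolation.reflect_eq {g : GTPattern μ} {lam : ℕ → ℕ} {x : ℕ × ℕ}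
    (hx : g.FirstViolation lam x) : g.reflect lam = g.toggle x.1 x.2 := by
  have h : ∃ x, g.FirstViolation lam x := ⟨x, hx⟩
  rw [reflect, dif_pos h, h.choose_spec.unique hx]

open Classical in
theorem alternant_mul_schurPoly {lam : ℕ →₀ ℕ} (hlam : Antitone lam) (n : ℕ) :
    alternant n (monomial (lam + rho n) 1) * schurPoly μ n =
      ∑ g : {g : GTPattern μ // g.BoundedBy n} with g.1.IsLR lam,
        alternant n (monomial (lam + g.1.weight + rho n) 1) := by
  have h1 : ∀ g : GTPattern μ, (monomial (lam + rho n) 1 * monomial g.weight 1 :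
      MvPolynomial ℕ ℤ) = monomial (lam + g.weight + rho n) 1 := fun g => by
    rw [monomial_mul, one_mul, add_right_comm]
  rw [← alternant_mul _ (rename_ofFin_eq fun k hk => rename_swap_schurPoly hk), schurPoly,
    mul_sum, map_sum, ← sum_filter_add_sum_filter_not _ fun g => g.1.IsLR lam]
  simp only [h1]
  rw [add_eq_left]
  have hv : ∀ g : {g : GTPattern μ // g.BoundedBy n}, g ∈ (univ.filter fun g => ¬ g.1.IsLR lam) →
      ∃ x, g.1.FirstViolation lam x ∧ x.2 + 1 < n := by
    intro g hg
    obtain ⟨x, hx⟩ := exists_firstViolation hlam (mem_filter.1 hg).2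
    exact ⟨x, hx, g.2.lt_of_violates hlam hx.2.1⟩
  have hb : ∀ g : {g : GTPattern μ // g.BoundedBy n}, g ∈ (univ.filter fun g => ¬ g.1.IsLR lam) →
      (g.1.reflect lam).BoundedBy n := by
    intro g hg
    obtain ⟨x, hx, hn⟩ := hv g hg
    rw [hx.reflect_eq]
    exact g.2.toggle hn _
  have hs : ∀ g : {g : GTPattern μ // g.BoundedBy n}, g ∈ (univ.filter fun g => ¬ g.1.IsLR lam) →
      alternant n (monomial (lam + g.1.weight + rho n) 1) +
        alternant n (monomial (lam + (g.1.reflect lam).weight + rho n) 1) = 0 := by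
    intro g hg
    obtain ⟨x, hx, hn⟩ := hv g hg
    rw [hx.reflect_eq, hx.alternant_toggle hn, add_neg_cancel]
  refine sum_involution (fun g hg => ⟨g.1.reflect lam, hb g hg⟩) hs ?_ ?_ ?_
  · intro g hg h0 h2
    have h3 := hs g hg
    have h4 : g.1.reflect lam = g.1 := congrArg Subtype.val h2
    rw [h4] at h3
    -- A fixed pattern contributes an alternant equal to its own negative, hence zero.
    exact h0 (add_self_eq_zero.1 h3)
  · intro g hg
    obtain ⟨x, hx, hn⟩ := hv g hg
    refine mem_filter.2 ⟨mem_univ _, fun h => ?_⟩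
    simp only [hx.reflect_eq] at h
    exact h _ _ hx.toggle.2.1
  · intro g hg
    obtain ⟨x, hx, hn⟩ := hv g hg
    apply Subtype.ext
    simp only [hx.reflect_eq, hx.toggle.reflect_eq, toggle_toggle]

theorem alternant_rho_ne_zero (n : ℕ) : alternant n (monomial (rho n) 1) ≠ 0 := by
  intro h
  have h0 : StrictAnti fun x : Fin n => rho n x := by
    simpa using strictAnti_add_rho (n := n) (α := 0) (fun _ _ _ => le_rfl)
  have h1 := coeff_alternant_monomial h0 h0
  rw [h] at h1
  simp at h1

theorem finite_support_rowLen (μ : YoungDiagram) : (Function.support μ.rowLen).Finite :=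
  (Set.finite_lt_nat (μ.colLen 0)).subset fun _ hk => not_le.1 fun h =>
    hk (YoungDiagram.rowLen_eq_zero h)

/-- The row lengths of a Young diagram. -/
noncomputable def rowLens (μ : YoungDiagram) : ℕ →₀ ℕ :=
  Finsupp.ofSupportFinite μ.rowLen (finite_support_rowLen μ)

theorem rowLens_apply (μ : YoungDiagram) (i : ℕ) : rowLens μ i = μ.rowLen i := rfl

theorem antitone_rowLens (μ : YoungDiagram) : Antitone (rowLens μ) := fun i j h =>
  μ.rowLen_anti i j h

theorem exists_rowLen_eq {f : ℕ →₀ ℕ} (hf : Antitone f) :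
    ∃ ν : YoungDiagram, ∀ i, ν.rowLen i = f i := by
  refine ⟨⟨f.support.sigma (fun i => range (f i)) |>.map
    (Equiv.sigmaEquivProd ℕ ℕ).toEmbedding, ?_⟩, fun i => ?_⟩
  · rintro ⟨a, b⟩ ⟨c, d⟩ ⟨h1, h2⟩ h
    simp at h h1 h2 ⊢
    have := hf h1
    omega
  · refine eq_of_forall_lt_iff fun j => ?_
    rw [← YoungDiagram.mem_iff_lt_rowLen, ← YoungDiagram.mem_cells]
    simp
    omega

theorem alternant_rho_mul_schurPoly {n : ℕ} (h : μ.colLen 0 ≤ n) :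
    alternant n (monomial (rho n) 1) * schurPoly μ n =
      alternant n (monomial (rowLens μ + rho n) 1) := by
  classical
  have h1 := alternant_mul_schurPoly (μ := μ) (lam := 0) (fun _ _ _ => le_rfl) n
  rw [zero_add] at h1
  rw [h1, sum_eq_single_of_mem ⟨highest μ, boundedBy_highest h⟩]
  · have : (highest μ).weight = rowLens μ := Finsupp.ext fun k => weight_highest k
    rw [zero_add, this]
  · exact mem_filter.2 ⟨mem_univ _, (isLR_zero_iff _).2 rfl⟩
  · intro g hg hne
    exact absurd (Subtype.ext ((isLR_zero_iff _).1 (mem_filter.1 hg).2)) hne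

open Classical in
theorem schurPoly_mul_schurPoly {lam : YoungDiagram} {n : ℕ} (hlam : lam.colLen 0 ≤ n)
    (shape : GTPattern μ → YoungDiagram)
    (hshape : ∀ g : GTPattern μ, g.IsLR (rowLens lam) →
      rowLens (shape g) = rowLens lam + g.weight) :
    schurPoly lam n * schurPoly μ n =
      ∑ g : {g : GTPattern μ // g.BoundedBy n} with g.1.IsLR (rowLens lam),
        schurPoly (shape g.1) n := by
  refine mul_left_cancel₀ (alternant_rho_ne_zero n) ?_
  rw [← mul_assoc, alternant_rho_mul_schurPoly hlam,
    alternant_mul_schurPoly (antitone_rowLens lam), mul_sum]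
  refine sum_congr rfl fun g hg => ?_
  have h := hshape g.1 (mem_filter.1 hg).2
  rw [alternant_rho_mul_schurPoly, h]
  -- The shape has at most `n` rows: neither `lam` nor a weight bounded by `n` contributes to row
  -- `n`.
  by_contra hn
  have h1 := (YoungDiagram.mem_iff_lt_rowLen.1
    (YoungDiagram.mem_iff_lt_colLen.2 (not_le.1 hn))).ne'
  refine h1 ?_
  rw [← rowLens_apply, h, Finsupp.add_apply, g.1.boundedBy_iff.1 g.2 n le_rfl, rowLens_apply,
    YoungDiagram.rowLen_eq_zero hlam]

end GTPattern

/-! ### The Littlewood–Richardson rule for Schur functions -/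

namespace GTPattern

open MvPolynomial

variable {μ : YoungDiagram}

/-- Below the last row of `lam` the weight itself is weakly decreasing, so an entry `k` there forces
all smaller entries down to `lam.colLen 0`; there are only |μ| boxes for them. The bound makes the
expansion finite, uniformly in the number of variables. -/
theorem IsLR.boundedBy {g : GTPattern μ} {lam : YoungDiagram} (h : g.IsLR (rowLens lam)) :
    g.BoundedBy (lam.colLen 0 + ∑ i ∈ range (μ.colLen 0), μ.rowLen i) := by
  rw [boundedBy_iff]
  intro k hk
  by_contra h0
  have h1 : ∀ l, lam.colLen 0 ≤ l → l ≤ k → 0 < g.weight l := by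
    intro l hl hlk
    have h2 := h.antitone_add_weight hlk
    simp only [rowLens_apply, YoungDiagram.rowLen_eq_zero hl,
      YoungDiagram.rowLen_eq_zero (hl.trans hlk)] at h2
    omega
  have h2 : ∀ d, lam.colLen 0 + d ≤ k → d < g.tail 0 (lam.colLen 0 + d + 1) := by
    intro d
    induction d with
    | zero =>
      intro hd
      rw [tail_succ]
      have := h1 _ le_rfl hd
      omega
    | succ d ih =>
      intro hd
      rw [tail_succ]
      have h3 := h1 (lam.colLen 0 + (d + 1)) (by omega) hd
      have h4 := ih (by omega)
      rw [← add_assoc] at h3 ⊢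
      omega
  obtain ⟨d, hd⟩ := Nat.exists_eq_add_of_le (show lam.colLen 0 ≤ k by omega)
  have h3 := h2 d hd.ge
  have h4 : g.tail 0 (lam.colLen 0 + d + 1) ≤ ∑ i ∈ range (μ.colLen 0), μ.rowLen i :=
    sum_le_sum fun i _ => g.row_le_rowLen _ _
  omega

instance finite_isLR (lam : YoungDiagram) : Finite {g : GTPattern μ // g.IsLR (rowLens lam)} :=
  Finite.of_injective
    (β := {g : GTPattern μ //
      g.BoundedBy (lam.colLen 0 + ∑ i ∈ range (μ.colLen 0), μ.rowLen i)})
    (fun g => ⟨g.1, g.2.boundedBy⟩) fun _ _ h => Subtype.ext (Subtype.mk.inj h)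

noncomputable instance (lam : YoungDiagram) :
    Fintype {g : GTPattern μ // g.IsLR (rowLens lam)} := Fintype.ofFinite _

open Classical in
/-- The partition obtained by adding the weight of a Littlewood–Richardson pattern to `lam`. -/
noncomputable def shape (lam : YoungDiagram) (g : GTPattern μ) : YoungDiagram :=
  if h : g.IsLR (rowLens lam) then
    (exists_rowLen_eq (f := rowLens lam + g.weight) h.antitone_add_weight).choose
  else lam

theorem IsLR.rowLens_shape {lam : YoungDiagram} {g : GTPattern μ} (h : g.IsLR (rowLens lam)) :
    rowLens (g.shape lam) = rowLens lam + g.weight := by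
  rw [shape, dif_pos h]
  exact Finsupp.ext
    (exists_rowLen_eq (f := rowLens lam + g.weight) h.antitone_add_weight).choose_spec

theorem rowLens_injective : Function.Injective rowLens := fun _ _ h =>
  YoungDiagram.ext_rowLen fun i => DFunLike.congr_fun h i

theorem exists_bound (α : ℕ →₀ ℕ) : ∃ n, ∀ k, n ≤ k → α k = 0 :=
  ⟨α.support.sup id + 1, fun k hk => by
    by_contra h
    have := le_sup (f := id) (Finsupp.mem_support_iff.2 h)
    simp only [id] at this
    omega⟩

/-- The Littlewood–Richardson rule. -/
theorem schur_mul_schur (lam μ : YoungDiagram) : lam.schur * μ.schur =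
    ∑ g : {g : GTPattern μ // g.IsLR (rowLens lam)}, (g.1.shape lam).schur := by
  classical
  ext α
  obtain ⟨m, hm⟩ := exists_bound α
  obtain ⟨n, hmn, hln, hn⟩ : ∃ n, m ≤ n ∧ lam.colLen 0 ≤ n ∧
      lam.colLen 0 + ∑ i ∈ range (μ.colLen 0), μ.rowLen i ≤ n :=
    ⟨m + (lam.colLen 0 + ∑ i ∈ range (μ.colLen 0), μ.rowLen i), by omega, by omega, by omega⟩
  have hα : ∀ k, n ≤ k → α k = 0 := fun k hk => hm k (hmn.trans hk)
  have h1 : MvPowerSeries.coeff α (lam.schur * μ.schur) =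
      coeff α (schurPoly lam n * schurPoly μ n) := by
    rw [MvPowerSeries.coeff_mul, coeff_mul]
    refine sum_congr rfl fun p hp => ?_
    rw [HasAntidiagonal.mem_antidiagonal] at hp
    have h2 : ∀ k, n ≤ k → p.1 k + p.2 k = 0 := fun k hk => by
      rw [← Finsupp.add_apply, hp, hα k hk]
    rw [coeff_schurPoly fun k hk => (Nat.add_eq_zero_iff.1 (h2 k hk)).1,
      coeff_schurPoly fun k hk => (Nat.add_eq_zero_iff.1 (h2 k hk)).2]
    rfl
  rw [h1, schurPoly_mul_schurPoly hln (shape lam) fun g => IsLR.rowLens_shape, coeff_sum, map_sum]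
  refine sum_bij (fun g hg => ⟨g.1, (mem_filter.1 hg).2⟩) (fun _ _ => mem_univ _) ?_ ?_ ?_
  · exact fun g _ h _ e => Subtype.ext (Subtype.mk.inj e)
  · exact fun g _ => ⟨⟨g.1, g.2.boundedBy.mono hn⟩, mem_filter.2 ⟨mem_univ _, g.2⟩, rfl⟩
  · exact fun g _ => coeff_schurPoly hα

/-- In enough variables, multiplication by a_ρ turns s_ν into a_{ν+ρ}, and the coefficient at
x^{ν+ρ} isolates the term of `ν`. -/
theorem linearIndependent_schur : LinearIndependent ℤ YoungDiagram.schur := by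
  rw [linearIndependent_iff]
  intro c hc
  obtain ⟨n, hn⟩ : ∃ n, ∀ ν ∈ c.support, ν.colLen 0 ≤ n :=
    ⟨c.support.sup fun ν => ν.colLen 0, fun ν hν => le_sup (f := fun ν => ν.colLen 0) hν⟩
  have h1 : ∑ ν ∈ c.support, c ν • schurPoly ν n = 0 := by
    ext α
    rw [coeff_sum, coeff_zero]
    by_cases hα : ∀ k, n ≤ k → α k = 0
    · rw [Finsupp.linearCombination_apply, Finsupp.sum] at hc
      have h2 := congrArg (MvPowerSeries.coeff α) hc
      rw [map_sum, map_zero] at h2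
      rw [← h2]
      refine sum_congr rfl fun ν _ => ?_
      rw [coeff_smul, coeff_schurPoly hα, map_smul]
      rfl
    · push Not at hα
      obtain ⟨k, hk, h0⟩ := hα
      exact sum_eq_zero fun ν _ => by rw [coeff_smul, coeff_schurPoly_of_ne hk h0, smul_zero]
  ext ν
  by_contra hν
  have hν' := Finsupp.mem_support_iff.2 hν
  have h2 := congrArg (fun f => coeff (rowLens ν + rho n) (alternant n (monomial (rho n) 1) * f)) h1
  simp only [mul_sum, mul_smul_comm, coeff_sum, mul_zero, coeff_zero] at h2
  rw [sum_eq_single_of_mem ν hν'] at h2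
  · rw [coeff_smul, alternant_rho_mul_schurPoly (hn ν hν'), coeff_alternant_monomial
      (strictAnti_add_rho (antitone_rowLens ν)) (strictAnti_add_rho (antitone_rowLens ν)),
      if_pos rfl, smul_eq_mul, mul_one] at h2
    exact hν h2
  · intro κ hκ hne
    rw [coeff_smul, alternant_rho_mul_schurPoly (hn κ hκ), coeff_alternant_monomial
      (strictAnti_add_rho (antitone_rowLens κ)) (strictAnti_add_rho (antitone_rowLens ν)),
      if_neg, smul_zero]
    exact fun h => hne (rowLens_injective (add_right_cancel h))

/-- The Littlewood–Richardson expansion of `s_lam s_μ`. -/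
noncomputable def lrExpansion (lam μ : YoungDiagram) : YoungDiagram →₀ ℤ :=
  ∑ g : {g : GTPattern μ // g.IsLR (rowLens lam)}, Finsupp.single (g.1.shape lam) 1

theorem isSchurExpansion_iff (lam μ : YoungDiagram) (c : YoungDiagram →₀ ℤ) :
    YoungDiagram.IsSchurExpansion (lam.schur * μ.schur) c ↔ c = lrExpansion lam μ := by
  have h : lam.schur * μ.schur =
      Finsupp.linearCombination ℤ YoungDiagram.schur (lrExpansion lam μ) := by
    rw [schur_mul_schur, lrExpansion, map_sum]
    exact sum_congr rfl fun g _ => by rw [Finsupp.linearCombination_single, one_smul]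
  rw [YoungDiagram.IsSchurExpansion, ← Finsupp.linearCombination_apply, h, eq_comm]
  exact linearIndependent_schur.eq_iff

theorem lrCoeff_eq (lam μ ν : YoungDiagram) :
    YoungDiagram.lrCoeff lam μ ν = lrExpansion lam μ ν := by
  have h : ∃ c, YoungDiagram.IsSchurExpansion (lam.schur * μ.schur) c :=
    ⟨_, (isSchurExpansion_iff lam μ _).2 rfl⟩
  rw [YoungDiagram.lrCoeff, dif_pos h, (isSchurExpansion_iff lam μ _).1 h.choose_spec]

theorem lrCoeff_eq_card {lam μ ν : YoungDiagram} {χ : ℕ →₀ ℕ}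
    (hν : rowLens ν = rowLens lam + χ) : YoungDiagram.lrCoeff lam μ ν =
      (Nat.card {g : GTPattern μ // g.IsLR (rowLens lam) ∧ g.weight = χ} : ℤ) := by
  classical
  rw [lrCoeff_eq, lrExpansion, Finsupp.finsetSum_apply]
  simp only [Finsupp.single_apply]
  rw [sum_boole, ← Fintype.card_subtype, ← Nat.card_eq_fintype_card]
  refine congrArg _ (Nat.card_congr ((Equiv.subtypeEquivRight fun g => ?_).trans
    (Equiv.subtypeSubtypeEquivSubtypeInter (fun g : GTPattern μ => g.IsLR (rowLens lam))
      fun g => g.weight = χ)))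
  rw [← rowLens_injective.eq_iff, g.2.rowLens_shape, hν, add_right_inj]

end GTPattern

/-! ### Comparison with the Kostka number -/

theorem proposition1 (lam μ ν : YoungDiagram) (χ : ℕ →₀ ℕ)
    (hν : ∀ i : ℕ, ν.rowLen i = lam.rowLen i + χ i) (hχ : χ.degree = μ.card) :
    (∃! c : YoungDiagram →₀ ℤ,
        YoungDiagram.IsSchurExpansion (YoungDiagram.schur lam * YoungDiagram.schur μ) c) ∧
      YoungDiagram.lrCoeff lam μ ν ≤ (YoungDiagram.kostka μ χ : ℤ) ∧
      (YoungDiagram.IsHorizontalStrip ν lam →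
        YoungDiagram.lrCoeff lam μ ν = (YoungDiagram.kostka μ χ : ℤ)) := by
  have hfin : Finite {g : GTPattern μ // g.weight = χ} := by
    have := SemistandardYoungTableau.finite_weight_eq μ χ
    exact Finite.of_equiv _ (SemistandardYoungTableau.equivGTPattern.subtypeEquiv
      (p := fun T => T.weight = χ) (q := fun g => g.weight = χ) fun T => by
        rw [← T.weight_toGTPattern]; rfl)
  rw [YoungDiagram.kostka, SemistandardYoungTableau.card_weight_eq,
    GTPattern.lrCoeff_eq_card (Finsupp.ext hν)]
  refine ⟨⟨_, (GTPattern.isSchurExpansion_iff lam μ _).2 rfl,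
    fun c hc => (GTPattern.isSchurExpansion_iff lam μ c).1 hc⟩, ?_, fun h => ?_⟩
  · exact_mod_cast Nat.card_le_card_of_injective
      (fun g : {g : GTPattern μ // g.IsLR (GTPattern.rowLens lam) ∧ g.weight = χ} =>
        (⟨g.1, g.2.2⟩ : {g : GTPattern μ // g.weight = χ}))
      fun _ _ e => Subtype.ext (Subtype.mk.inj e)
  · refine congrArg _ (Nat.card_congr (Equiv.subtypeEquivRight fun g => and_iff_right_of_imp ?_))
    rintro rfl
    refine g.isLR_of_forall_add_weight_le fun k => ?_
    rw [GTPattern.rowLens_apply, GTPattern.rowLens_apply, ← hν]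
    by_contra hk
    have h1 := ν.rowLen_anti k (k + 1) (by omega)
    have h2 := lam.rowLen_anti k (k + 1) (by omega)
    -- If ν_{k+1} > λ_k, the boxes of rows `k` and `k + 1` in column λ_k both lie in ν/λ.
    have := h.2 k (k + 1) (lam.rowLen k)
    simp only [YoungDiagram.mem_iff_lt_rowLen] at this
    have := this (by omega) (by omega) (by omega) (by omega)
    omega
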